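/- Let $f:\mathbb R^n\times\mathbb R^m\to\mathbb R$ be twice continuously differentiable and let $z^*=(x^*,y^*)$ be a stationary point of $f$, i.e. $\partial_x f(z^*)=0$ and $\partial_y f(z^*)=0$. For $\alpha_1,\alpha_2>0$ put $v(z)=(-\alpha_1\,\partial_x f(z),\ \alpha_2\,\partial_y f(z))$. For $\beta>0$, the extra-gradient method $\mathrm{EG}(\alpha_1,\alpha_2,\beta)$ is the iteration $$z_{t+1}=z_t+\tfrac1\beta\, v(z_{t+1/2}),\qquad z_{t+1/2}=z_t+v(z_t),$$ and for $k>1$, optimistic gradient descent $\mathrm{OGD}(k,\alpha_1,\alpha_2)$ is the iteration $$z_{t+1}=z_t+k\,v(z_t)-v(z_{t-1}),$$ regarded as a map $(z_t,z_{t-1})\mapsto(z_{t+1},z_t)$. Such an algorithm is called exponentially stable at $z^*$ if $z^*$ (respectively $(z^*,z^*)$) is a fixed point of its update map, the update map is differentiable there, and its Jacobian matrix there has spectral radius (the maximal modulus of its complex eigenvalues) less than one. Suppose that at $z^*$ $$\partial^2_{yy}f\prec 0\qquad\text{and}\qquad \partial^2_{xx}f-\partial^2_{xy}f\,(\partial^2_{yy}f)^{-1}\,\partial^2_{yx}f\succ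 0 .$$ Then there is $\gamma_0>0$ such that for all $\beta_0>0$ and $K>1$ there is $\alpha_0>0$ with the following property: for all $\gamma>\gamma_0$ and $0<\alpha_2<\alpha_0$, with $\alpha_1=\alpha_2/\gamma$, the method $\mathrm{EG}(\alpha_1,\alpha_2,\beta)$ is exponentially stable at $z^*$ for every $\beta\ge\beta_0$, and $\mathrm{OGD}(k,\alpha_1,\alpha_2)$ is exponentially stable at $z^*$ for every $1<k\le K$. In particular, for each fixed $\beta>0$ and each fixed $k>1$ there are $\gamma_0,\alpha_0>0$ such that $\mathrm{EG}(\alpha_1,\alpha_2,\beta)$ and $\mathrm{OGD}(k,\alpha_1,\alpha_2)$ are exponentially stable at $z^*$ whenever $\gamma>\gamma_0$, $0<\alpha_2<\alpha_0$ and $\alpha_1=\alpha_2/\gamma$. -/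

import Mathlib

open scoped TensorProduct

noncomputable section

namespace MinimaxStability

/-- The space `ℝⁿ × ℝᵐ` of strategy pairs `z = (x, y)`, each factor being Euclidean. -/
abbrev Pair (n m : ℕ) : Type := EuclideanSpace ℝ (Fin n) × EuclideanSpace ℝ (Fin m)

variable {n m : ℕ}

/-- The partial gradient `∂ₓ f (x, y) ∈ ℝⁿ`. -/
def gradX (f : Pair n m → ℝ) (z : Pair n m) : EuclideanSpace ℝ (Fin n) :=
  gradient (fun x => f (x, z.2)) z.1

/-- The partial gradient `∂ᵧ f (x, y) ∈ ℝᵐ`. -/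
def gradY (f : Pair n m → ℝ) (z : Pair n m) : EuclideanSpace ℝ (Fin m) :=
  gradient (fun y => f (z.1, y)) z.2

/-- `z` is a stationary point of `f`: both partial gradients vanish. -/
def IsStationary (f : Pair n m → ℝ) (z : Pair n m) : Prop :=
  gradX f z = 0 ∧ gradY f z = 0

/-- The `i`-th coordinate direction of the `x`-variable. -/
def dirX (n m : ℕ) (i : Fin n) : Pair n m := (EuclideanSpace.single i 1, 0)

/-- The `j`-th coordinate direction of the `y`-variable. -/
def dirY (n m : ℕ) (j : Fin m) : Pair n m := (0, EuclideanSpace.single j 1)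

/-- The iterated directional derivative `∂_u ∂_w f` at `z`. -/
def secondDeriv (f : Pair n m → ℝ) (z u w : Pair n m) : ℝ :=
  fderiv ℝ (fun q => fderiv ℝ f q w) z u

/-- The Hessian block `∂²ₓₓ f`, of size `n × n`. -/
def hessXX (f : Pair n m → ℝ) (z : Pair n m) : Matrix (Fin n) (Fin n) ℝ :=
  Matrix.of fun i j => secondDeriv f z (dirX n m i) (dirX n m j)

/-- The Hessian block `∂²ₓᵧ f`, of size `n × m`. -/
def hessXY (f : Pair n m → ℝ) (z : Pair n m) : Matrix (Fin n) (Fin m) ℝ :=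
  Matrix.of fun i j => secondDeriv f z (dirX n m i) (dirY n m j)

/-- The Hessian block `∂²ᵧₓ f`, of size `m × n`. -/
def hessYX (f : Pair n m → ℝ) (z : Pair n m) : Matrix (Fin m) (Fin n) ℝ :=
  Matrix.of fun i j => secondDeriv f z (dirY n m i) (dirX n m j)

/-- The Hessian block `∂²ᵧᵧ f`, of size `m × m`. -/
def hessYY (f : Pair n m → ℝ) (z : Pair n m) : Matrix (Fin m) (Fin m) ℝ :=
  Matrix.of fun i j => secondDeriv f z (dirY n m i) (dirY n m j)

/-- The two-time-scale gradient field `v(z) = (-α₁ ∂ₓ f(z), α₂ ∂ᵧ f(z))`. -/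
def field (f : Pair n m → ℝ) (α₁ α₂ : ℝ) (z : Pair n m) : Pair n m :=
  (-(α₁ • gradX f z), α₂ • gradY f z)

/-- One step of the extra-gradient method `EG(α₁, α₂, β)`:
`z_{t+1} = z_t + v(z_{t+1/2}) / β` with `z_{t+1/2} = z_t + v(z_t)`. -/
def egStep (f : Pair n m → ℝ) (α₁ α₂ β : ℝ) (z : Pair n m) : Pair n m :=
  z + β⁻¹ • field f α₁ α₂ (z + field f α₁ α₂ z)

/-- One step of optimistic gradient descent `OGD(k, α₁, α₂)`,
`z_{t+1} = z_t + k v(z_t) - v(z_{t-1})`, as a map on states `(z_t, z_{t-1})`. -/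
def ogdStep (f : Pair n m → ℝ) (k α₁ α₂ : ℝ) (s : Pair n m × Pair n m) :
    Pair n m × Pair n m :=
  (s.1 + k • field f α₁ α₂ s.1 - field f α₁ α₂ s.2, s.1)

/-- The iteration `s_{t+1} = T s_t` is exponentially stable at `p`: `p` is a fixed point of `T`,
`T` is differentiable there, and the Jacobian of `T` at `p` has spectral radius less than one.
The spectrum is the set of complex eigenvalues, i.e. that of the complexified Jacobian. -/
def ExponentiallyStable {E : Type*} [NormedAddCommGroup E] [NormedSpace ℝ E]
    (T : E → E) (p : E) : Prop :=
  T p = p ∧ DifferentiableAt ℝ T p ∧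
    spectralRadius ℂ
      (LinearMap.baseChange ℂ (fderiv ℝ T p : E →ₗ[ℝ] E) : Module.End ℂ (ℂ ⊗[ℝ] E)) < 1

end MinimaxStability

end

/-! Let `V` be the Jacobian of the field at the stationary point and `D` = (∂²ᵧᵧf)⁻¹∂²ᵧₓf. In the
coordinates (x, w) with w = y + D x the Hessian form is block diagonal: the Schur complement on x
and ∂²ᵧᵧf on w. The fast ascent direction then depends on w alone, so every remaining coupling
carries the factor ε = 1/γ and is absorbed once ε is small. This gives ⟨p, V p⟩ ≤ -(c/α₂)‖V p‖² in
the sheared inner product, with `c` independent of ε (`exists_dissipative`).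

For an eigenvalue s of `V` this reads Re s ≤ -(c/α₂)|s|², that is Re(1/s) ≤ -c/α₂: the spectrum lies
in a small disc tangent to the imaginary axis at 0 from the left (`exists_eigenvalue_bound`). Mere
negativity of Re s would not suffice, since ε may be arbitrarily small; the tangent disc shrinks
with α₂ uniformly in γ.

Both algorithms act on eigenvalues by explicit scalar relations: the multiplier is 1 + s(1+s)/β for
EG, and a root of (kμ-1)s = μ(μ-1) for OGD. Each is contracting as soon as c/α₂ exceeds a threshold
depending only on β or k (`extragradient_multiplier_lt_one`, `optimistic_multiplier_lt_one`). -/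

namespace MinimaxStability

/-! ### Complex eigenvalues of a real operator. -/

section Complexification

variable {E F : Type*} [AddCommGroup E] [Module ℝ E] [AddCommGroup F] [Module ℝ F]

/-- The real part `E_ℂ → E` of the complexification. -/
noncomputable def rePart (E : Type*) [AddCommGroup E] [Module ℝ E] : ℂ ⊗[ℝ] E →ₗ[ℝ] E :=
  (TensorProduct.lid ℝ E).toLinearMap ∘ₗ Complex.reLm.rTensor E

/-- The imaginary part `E_ℂ → E` of the complexification. -/
noncomputable def imPart (E : Type*) [AddCommGroup E] [Module ℝ E] : ℂ ⊗[ℝ] E →ₗ[ℝ] E :=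
  (TensorProduct.lid ℝ E).toLinearMap ∘ₗ Complex.imLm.rTensor E

@[simp] lemma rePart_tmul (c : ℂ) (a : E) : rePart E (c ⊗ₜ a) = c.re • a := by simp [rePart]

@[simp] lemma imPart_tmul (c : ℂ) (a : E) : imPart E (c ⊗ₜ a) = c.im • a := by simp [imPart]

lemma rePart_add_imPart (v : ℂ ⊗[ℝ] E) :
    (1 : ℂ) ⊗ₜ[ℝ] rePart E v + Complex.I ⊗ₜ[ℝ] imPart E v = v := by
  induction v using TensorProduct.induction_on with
  | zero => simp
  | tmul c a =>
    rw [rePart_tmul, imPart_tmul, ← TensorProduct.smul_tmul, ← TensorProduct.smul_tmul,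
      ← TensorProduct.add_tmul]
    congr 1
    apply Complex.ext <;> simp
  | add u v hu hv =>
    rw [map_add, map_add, TensorProduct.tmul_add, TensorProduct.tmul_add, add_add_add_comm, hu, hv]

lemma rePart_smul (c : ℂ) (v : ℂ ⊗[ℝ] E) :
    rePart E (c • v) = c.re • rePart E v - c.im • imPart E v := by
  induction v using TensorProduct.induction_on with
  | zero => simp
  | tmul d a => simp [TensorProduct.smul_tmul', sub_smul, mul_smul]
  | add u v hu hv => simp only [smul_add, map_add, hu, hv]; abel

lemma imPart_smul (c : ℂ) (v : ℂ ⊗[ℝ] E) :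
    imPart E (c • v) = c.re • imPart E v + c.im • rePart E v := by
  induction v using TensorProduct.induction_on with
  | zero => simp
  | tmul d a => simp [TensorProduct.smul_tmul', add_smul, mul_smul]
  | add u v hu hv => simp only [smul_add, map_add, hu, hv]; abel

lemma rePart_baseChange (T : E →ₗ[ℝ] F) (v : ℂ ⊗[ℝ] E) :
    rePart F (T.baseChange ℂ v) = T (rePart E v) := by
  induction v using TensorProduct.induction_on with
  | zero => simp
  | tmul d a => simp
  | add u v hu hv => simp only [map_add, hu, hv]

lemma imPart_baseChange (T : E →ₗ[ℝ] F) (v : ℂ ⊗[ℝ] E) :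
    imPart F (T.baseChange ℂ v) = T (imPart E v) := by
  induction v using TensorProduct.induction_on with
  | zero => simp
  | tmul d a => simp
  | add u v hu hv => simp only [map_add, hu, hv]

/-- An eigenvalue of the complexification of a real operator acts on the span of the real and
imaginary parts of its eigenvector as a rotation-scaling. -/
lemma exists_pair_of_baseChange_apply_eq {T : E →ₗ[ℝ] E} {μ : ℂ} {v : ℂ ⊗[ℝ] E} (hv : v ≠ 0)
    (h : T.baseChange ℂ v = μ • v) :
    ∃ a b : E, (a ≠ 0 ∨ b ≠ 0) ∧ T a = μ.re • a - μ.im • b ∧ T b = μ.re • b + μ.im • a := by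
  refine ⟨rePart E v, imPart E v, ?_, ?_, ?_⟩
  · by_contra! h0
    exact hv (by rw [← rePart_add_imPart v, h0.1, h0.2]; simp)
  · rw [← rePart_baseChange, h, rePart_smul]
  · rw [← imPart_baseChange, h, imPart_smul]

/-- A dissipativity estimate for a real operator, read in the inner product pulled back along an
injective map, localizes its complex eigenvalues. -/
lemma eigenvalue_re_of_dissipative {F : Type*} [NormedAddCommGroup F] [InnerProductSpace ℝ F]
    {T : E →ₗ[ℝ] E} {L : E →ₗ[ℝ] F} {c : ℝ}
    (hneg : ∀ a, a ≠ 0 → inner ℝ (L a) (L (T a)) < 0)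
    (hdis : ∀ a, inner ℝ (L a) (L (T a)) ≤ -c * ‖L (T a)‖ ^ 2)
    {μ : ℂ} {v : ℂ ⊗[ℝ] E} (hv : v ≠ 0) (h : T.baseChange ℂ v = μ • v) :
    μ.re < 0 ∧ μ.re ≤ -c * (μ.re ^ 2 + μ.im ^ 2) := by
  obtain ⟨a, b, hab, ha, hb⟩ := exists_pair_of_baseChange_apply_eq hv h
  have hneg' : ∀ a, inner ℝ (L a) (L (T a)) ≤ 0 := fun a => by
    rcases eq_or_ne a 0 with rfl | h0
    · simp
    · exact (hneg a h0).le
  -- Adding the identities for the real and imaginary parts cancels the cross terms in ⟨La, Lb⟩.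
  have hsum : inner ℝ (L a) (L (T a)) + inner ℝ (L b) (L (T b))
      = μ.re * (‖L a‖ ^ 2 + ‖L b‖ ^ 2) := by
    rw [ha, hb]
    simp only [map_sub, map_add, map_smul, inner_sub_right, inner_add_right, inner_smul_right,
      real_inner_self_eq_norm_sq, real_inner_comm (L a) (L b)]
    ring
  have hnorm : ‖L (T a)‖ ^ 2 + ‖L (T b)‖ ^ 2
      = (μ.re ^ 2 + μ.im ^ 2) * (‖L a‖ ^ 2 + ‖L b‖ ^ 2) := by
    rw [ha, hb]
    simp only [← real_inner_self_eq_norm_sq, map_sub, map_add, map_smul, inner_sub_right,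
      inner_add_right, inner_sub_left, inner_add_left, real_inner_smul_right,
      real_inner_smul_left, real_inner_comm (L a) (L b)]
    ring
  have hlt : μ.re * (‖L a‖ ^ 2 + ‖L b‖ ^ 2) < 0 := by
    rw [← hsum]
    rcases hab with h0 | h0
    · linarith [hneg a h0, hneg' b]
    · linarith [hneg b h0, hneg' a]
  -- Injectivity of `L` is not assumed: the strict inequality `hneg` already forces L a ≠ 0 for a ≠
  -- 0.
  have hN : 0 < ‖L a‖ ^ 2 + ‖L b‖ ^ 2 := by
    refine lt_of_le_of_ne (by positivity) fun h0 => ?_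
    rw [← h0] at hlt
    simp at hlt
  refine ⟨by by_contra! h0; nlinarith, ?_⟩
  refine le_of_mul_le_mul_right ?_ hN
  rw [← hsum, mul_assoc, ← hnorm]
  linarith [hdis a, hdis b]

end Complexification

/-! ### Spectral radius in finite dimension. -/

section SpectralRadius

/-- In finite dimension the spectral radius is below one as soon as every eigenvalue is. -/
lemma spectralRadius_lt_one {V : Type*} [AddCommGroup V] [Module ℂ V] [FiniteDimensional ℂ V]
    {T : Module.End ℂ V} (h : ∀ μ ∈ spectrum ℂ T, ‖μ‖ < 1) : spectralRadius ℂ T < 1 := by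
  have hfin : (spectrum ℂ T).Finite := by
    refine (Module.End.finite_hasEigenvalue T).subset fun μ hμ => ?_
    exact Module.End.hasEigenvalue_iff_mem_spectrum.2 hμ
  unfold spectralRadius
  rcases (spectrum ℂ T).eq_empty_or_nonempty with h0 | ⟨μ, hμ⟩
  · simp [h0]
  · rw [hfin.ciSup_lt_iff ⟨μ, hμ, by simp⟩]
    intro ν hν
    exact_mod_cast h ν hν

end SpectralRadius

/-! ### Scalar estimates for the two multipliers. -/

section Scalar

/-- Extra-gradient turns a dissipative eigenvalue into a contracting one. -/
lemma extragradient_multiplier_lt_one {s : ℂ} {β c : ℝ} (hβ : 0 < β) (hs : s.re < 0)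
    (hc : s.re ≤ -c * (s.re ^ 2 + s.im ^ 2)) (hcβ : 1 + 2 / β < c) :
    ‖1 + (β : ℂ)⁻¹ * (s * (1 + s))‖ < 1 := by
  have hc1 : 1 < c := by have : 0 < 2 / β := by positivity
                         linarith
  have hβc : β + 2 < β * c := by
    have := mul_lt_mul_of_pos_left hcβ hβ
    rwa [mul_add, mul_div_cancel₀ _ hβ.ne', mul_one] at this
  obtain ⟨a, b⟩ := s
  simp only at hs hc
  set N := a ^ 2 + b ^ 2 with hN
  have hNpos : 0 < N := by have := mul_self_pos.2 hs.ne; nlinarith [sq_nonneg b]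
  have ha : a ≤ -N := by nlinarith
  -- From a² ≤ N ≤ -a follows |a| ≤ 1, hence N ≤ 1; this bounds |1+s|² by 2 below.
  have hN1 : N ≤ 1 := by nlinarith [sq_nonneg b]
  have hw : (⟨a, b⟩ : ℂ) * (1 + ⟨a, b⟩) = ⟨a + a ^ 2 - b ^ 2, b + 2 * a * b⟩ := by
    apply Complex.ext <;> simp <;> ring
  have hsq : ‖1 + (β : ℂ)⁻¹ * ((⟨a, b⟩ : ℂ) * (1 + ⟨a, b⟩))‖ ^ 2 < 1 := by
    rw [hw, ← Complex.ofReal_inv, Complex.sq_norm, Complex.normSq_apply]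
    simp only [Complex.add_re, Complex.add_im, Complex.one_re, Complex.one_im,
      Complex.re_ofReal_mul, Complex.im_ofReal_mul]
    -- With w = s(1+s), |1 + w/β|² - 1 = β⁻²(2β Re w + |w|²). The dissipative bound gives Re w ≤
    -- (1-c)N, and |w|² ≤ 2N.
    have hkey : 2 * β * (a + a ^ 2 - b ^ 2) + N * (1 + 2 * a + N) < 0 := by
      have h1 : 2 * β * (a + a ^ 2 - b ^ 2) ≤ 2 * β * (N - c * N) := by
        apply mul_le_mul_of_nonneg_left _ (by positivity)
        nlinarith [sq_nonneg b]
      have h2 : N * (1 + 2 * a + N) ≤ N * 2 := by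
        apply mul_le_mul_of_nonneg_left _ hNpos.le
        linarith
      nlinarith
    have hexp : (1 + β⁻¹ * (a + a ^ 2 - b ^ 2)) * (1 + β⁻¹ * (a + a ^ 2 - b ^ 2))
        + (0 + β⁻¹ * (b + 2 * a * b)) * (0 + β⁻¹ * (b + 2 * a * b))
        = 1 + β⁻¹ ^ 2 * (2 * β * (a + a ^ 2 - b ^ 2) + N * (1 + 2 * a + N)) := by
      rw [hN]; field_simp; ring
    rw [hexp]
    have : 0 < β⁻¹ ^ 2 := by positivity
    nlinarith
  nlinarith [norm_nonneg (1 + (β : ℂ)⁻¹ * ((⟨a, b⟩ : ℂ) * (1 + ⟨a, b⟩)))]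

/-- Inversion sends the exterior of the unit disc, translated by -1, into the half-plane Re ≥ -1/2.
At μ = 1 the convention 0⁻¹ = 0 keeps the bound true. -/
lemma neg_half_le_re_inv_sub_one {μ : ℂ} (hμ : 1 ≤ ‖μ‖) : -(1 / 2) ≤ ((μ - 1)⁻¹).re := by
  rcases eq_or_ne μ 1 with rfl | h1
  · norm_num
  have hpos : 0 < Complex.normSq (μ - 1) := Complex.normSq_pos.2 (sub_ne_zero.2 h1)
  rw [Complex.inv_re, le_div_iff₀ hpos]
  have : 1 ≤ Complex.normSq μ := by rw [← Complex.sq_norm]; nlinarith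
  rw [Complex.normSq_apply] at this ⊢
  simp
  nlinarith

lemma ofReal_mul_sub_one_ne_zero {k : ℝ} {μ : ℂ} (hk : 1 < k) (hμ : 1 ≤ ‖μ‖) :
    (k : ℂ) * μ - 1 ≠ 0 := fun h0 => by
  have : ‖(k : ℂ) * μ‖ = 1 := by rw [sub_eq_zero.1 h0]; simp
  rw [norm_mul, Complex.norm_real, Real.norm_of_nonneg (by linarith)] at this
  nlinarith

/-- Optimistic gradient descent turns a dissipative eigenvalue into contracting ones. -/
lemma optimistic_multiplier_lt_one {s μ : ℂ} {k c : ℝ} (hk : 1 < k) (hs : s.re < 0)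
    (hc : s.re ≤ -c * (s.re ^ 2 + s.im ^ 2)) (hck : (k + 1) / 2 < c)
    (h : (k * μ - 1) * s = μ * (μ - 1)) : ‖μ‖ < 1 := by
  by_contra! hμ
  have hs0 : s ≠ 0 := fun h0 => by simp [h0] at hs
  have hμ0 : μ ≠ 0 := fun h0 => by simp [h0] at hμ; linarith
  have hkμ := ofReal_mul_sub_one_ne_zero hk hμ
  have hμ1 : μ - 1 ≠ 0 := fun h0 => by
    rw [h0, mul_zero] at h
    exact (mul_ne_zero hkμ hs0) h
  -- Partial fractions of (kμ-1)/(μ(μ-1)). If |μ| ≥ 1 the two terms have real parts at least -1 and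
  -- -(k-1)/2, which contradicts Re(1/s) ≤ -c < -(k+1)/2.
  have hinv : s⁻¹ = μ⁻¹ + ((k - 1 : ℝ) : ℂ) * (μ - 1)⁻¹ := by
    have : s = μ * (μ - 1) / (k * μ - 1) := by rw [eq_div_iff hkμ, ← h]; ring
    rw [this]
    push_cast
    field_simp
    ring
  have hlow : -((k + 1) / 2) ≤ (s⁻¹).re := by
    rw [hinv, Complex.add_re, Complex.re_ofReal_mul]
    have h1 : -1 ≤ (μ⁻¹).re := by
      have h2 := (abs_le.1 (Complex.abs_re_le_norm μ⁻¹)).1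
      have h3 : ‖μ⁻¹‖ ≤ 1 := by rw [norm_inv]; exact inv_le_one_of_one_le₀ hμ
      linarith
    nlinarith [neg_half_le_re_inv_sub_one hμ]
  have hpos : 0 < Complex.normSq s := Complex.normSq_pos.2 hs0
  rw [Complex.inv_re, le_div_iff₀ hpos, Complex.normSq_apply] at hlow
  rw [Complex.normSq_apply] at hpos
  nlinarith

end Scalar

/-! ### From eigenvalues of the update map to eigenvalues of the field. -/

section Multipliers

variable {E : Type*} [AddCommGroup E] [Module ℝ E] [FiniteDimensional ℝ E]

/-- The Jacobian is the nonconstant polynomial 1 + X(1+X)/β in `V`, so spectral mapping applies. -/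
lemma extragradient_spectrum {V : E →ₗ[ℝ] E} {β : ℝ} (hβ : 0 < β) {μ : ℂ}
    (hμ : μ ∈ spectrum ℂ (LinearMap.baseChange ℂ
      (LinearMap.id + β⁻¹ • V ∘ₗ (LinearMap.id + V)) : Module.End ℂ (ℂ ⊗[ℝ] E))) :
    ∃ s : ℂ, ∃ v : ℂ ⊗[ℝ] E, v ≠ 0 ∧ V.baseChange ℂ v = s • v ∧
      μ = 1 + (β : ℂ)⁻¹ * (s * (1 + s)) := by
  let p : Polynomial ℂ := 1 + .C (β : ℂ)⁻¹ * (.X * (1 + .X))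
  have hp : LinearMap.baseChange ℂ (LinearMap.id + β⁻¹ • V ∘ₗ (LinearMap.id + V))
      = Polynomial.aeval (V.baseChange ℂ : Module.End ℂ (ℂ ⊗[ℝ] E)) p := by
    ext x
    simp [p, TensorProduct.tmul_add, TensorProduct.smul_tmul']
  have hdeg : 0 < p.degree := by
    have : p.degree = 2 := by
      have : (β : ℂ)⁻¹ ≠ 0 := by simpa using hβ.ne'
      simp only [p]
      compute_degree!
      exact hβ.ne'
    rw [this]; norm_num
  rw [hp, spectrum.map_polynomial_aeval_of_degree_pos _ _ hdeg] at hμ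
  obtain ⟨s, hs, rfl⟩ := hμ
  obtain ⟨v, hv⟩ := (Module.End.HasEigenvalue.of_mem_spectrum hs).exists_hasEigenvector
  exact ⟨s, v, hv.2, hv.apply_eq_smul, by simp [p]⟩

/-- An eigenvector (P, Q) of the companion-type Jacobian has P = μQ, and its first row becomes
(kμ-1)VQ = μ(μ-1)Q. Since |μ| ≥ 1 and k > 1 exclude kμ = 1, Q is an eigenvector of `V`. -/
lemma optimistic_spectrum {V : E →ₗ[ℝ] E} {k : ℝ} (hk : 1 < k) {μ : ℂ} (hμ1 : 1 ≤ ‖μ‖)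
    (hμ : μ ∈ spectrum ℂ (LinearMap.baseChange ℂ
      ((LinearMap.fst ℝ E E + k • V ∘ₗ LinearMap.fst ℝ E E - V ∘ₗ LinearMap.snd ℝ E E).prod
        (LinearMap.fst ℝ E E)) : Module.End ℂ (ℂ ⊗[ℝ] (E × E)))) :
    ∃ s : ℂ, ∃ v : ℂ ⊗[ℝ] E, v ≠ 0 ∧ V.baseChange ℂ v = s • v ∧
      (k * μ - 1) * s = μ * (μ - 1) := by
  obtain ⟨u, hu⟩ := (Module.End.HasEigenvalue.of_mem_spectrum hμ).exists_hasEigenvector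
  have hu0 := hu.2
  have hap := hu.apply_eq_smul
  set T := (LinearMap.fst ℝ E E + k • V ∘ₗ LinearMap.fst ℝ E E - V ∘ₗ LinearMap.snd ℝ E E).prod
        (LinearMap.fst ℝ E E) with hT
  set P := (LinearMap.fst ℝ E E).baseChange ℂ u with hP
  set Q := (LinearMap.snd ℝ E E).baseChange ℂ u with hQ
  have h2 : P = μ • Q := by
    rw [hQ, ← map_smul, ← hap, ← LinearMap.comp_apply, ← LinearMap.baseChange_comp, hT,
      LinearMap.snd_prod]
  have h1 : P + (k : ℂ) • V.baseChange ℂ P - V.baseChange ℂ Q = μ • P := by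
    have : μ • P = (LinearMap.fst ℝ E E ∘ₗ T).baseChange ℂ u := by
      rw [LinearMap.baseChange_comp, LinearMap.comp_apply, hap, map_smul]
    rw [this, hT, LinearMap.fst_prod, LinearMap.baseChange_sub, LinearMap.baseChange_add,
      LinearMap.baseChange_smul, LinearMap.baseChange_comp, LinearMap.baseChange_comp]
    simp [hP, hQ]
    rfl
  have hQ0 : Q ≠ 0 := fun h0 => hu0 <| by
    have hid : (LinearMap.inl ℝ E E ∘ₗ LinearMap.fst ℝ E E
        + LinearMap.inr ℝ E E ∘ₗ LinearMap.snd ℝ E E) = LinearMap.id := by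
      ext <;> simp
    have : u = (LinearMap.inl ℝ E E).baseChange ℂ P + (LinearMap.inr ℝ E E).baseChange ℂ Q := by
      rw [hP, hQ, ← LinearMap.comp_apply, ← LinearMap.comp_apply, ← LinearMap.add_apply,
        ← LinearMap.baseChange_comp, ← LinearMap.baseChange_comp, ← LinearMap.baseChange_add, hid,
        LinearMap.baseChange_id, LinearMap.id_apply]
    rw [this, h2, h0]
    simp
  have hkμ := ofReal_mul_sub_one_ne_zero hk hμ1
  refine ⟨μ * (μ - 1) / (k * μ - 1), Q, hQ0, ?_, by field_simp⟩
  have h3 : ((k : ℂ) * μ - 1) • V.baseChange ℂ Q = (μ * (μ - 1)) • Q := by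
    rw [h2, map_smul] at h1
    rw [← sub_eq_zero] at h1 ⊢
    rw [← h1]
    module
  rw [div_eq_inv_mul, mul_smul, ← h3, smul_smul, inv_mul_cancel₀ hkμ, one_smul]

end Multipliers

/-! ### The energy estimate in sheared coordinates. -/

section Energy

lemma exists_coercive {X : Type*} [NormedAddCommGroup X] [NormedSpace ℝ X]
    [FiniteDimensional ℝ X] {B : X →L[ℝ] X →L[ℝ] ℝ} (hB : ∀ x, x ≠ 0 → 0 < B x x) :
    ∃ s, 0 < s ∧ ∀ x, s * ‖x‖ ^ 2 ≤ B x x := by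
  have : ProperSpace X := FiniteDimensional.proper ℝ X
  rcases (Metric.sphere (0 : X) 1).eq_empty_or_nonempty with h0 | hne
  -- An empty unit sphere means that the space is trivial, so any constant works.
  · refine ⟨1, one_pos, fun x => ?_⟩
    rcases eq_or_ne x 0 with rfl | hx
    · simp
    · have : (‖x‖⁻¹ • x) ∈ Metric.sphere (0 : X) 1 := by simp [norm_smul, hx]
      simp [h0] at this
  · obtain ⟨x₀, hx₀, hmin⟩ := (isCompact_sphere (0 : X) 1).exists_isMinOn hne
      (f := fun x => B x x) (by fun_prop)
    have hx₀0 : x₀ ≠ 0 := fun h => by simp [h] at hx₀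
    refine ⟨B x₀ x₀, hB x₀ hx₀0, fun x => ?_⟩
    rcases eq_or_ne x 0 with rfl | hx
    · simp
    · have hmem : (‖x‖⁻¹ • x) ∈ Metric.sphere (0 : X) 1 := by simp [norm_smul, hx]
      have h := isMinOn_iff.1 hmin _ hmem
      have hpos : 0 < ‖x‖ := norm_pos_iff.2 hx
      simp only [map_smul, smul_apply, smul_eq_mul] at h
      calc B x₀ x₀ * ‖x‖ ^ 2 ≤ (‖x‖⁻¹ * (‖x‖⁻¹ * B x x)) * ‖x‖ ^ 2 := by gcongr
        _ = B x x := by field_simp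

/-- Here a = ‖x‖, b = ‖w‖, q is the energy product and r the squared norm of the field. Young's
inequality absorbs the O(ε) cross term. Since ε² ≤ ε, the dissipation εa² + b² dominates ε²a² + b²,
hence r, with a constant free of ε. -/
lemma energy_scalar_bound {s c M ε a b q r : ℝ} (hs : 0 < s) (hc : 0 < c) (hM : 0 < M)
    (hε : 0 < ε) (hε1 : ε ≤ 1) (hεM : ε * (M + M ^ 2 / (2 * s)) ≤ c / 2)
    (hq : q ≤ -(ε * s * a ^ 2) - c * b ^ 2 + ε * M * (a + b) * b)
    (hr : r ≤ M * (ε ^ 2 * a ^ 2 + b ^ 2)) :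
    q ≤ -(ε * s * a ^ 2 + c * b ^ 2) / 2 ∧ q ≤ -(min s c / (2 * M)) * r := by
  have hq' : q ≤ -(ε * s * a ^ 2 + c * b ^ 2) / 2 := by
    have h1 : M * a * b ≤ s / 2 * a ^ 2 + M ^ 2 / (2 * s) * b ^ 2 := by
      have h : 0 ≤ (s * a - M * b) ^ 2 / (2 * s) := by positivity
      have h' : (s * a - M * b) ^ 2 / (2 * s)
          = s / 2 * a ^ 2 + M ^ 2 / (2 * s) * b ^ 2 - M * a * b := by field_simp; ring
      linarith
    have h2 := mul_le_mul_of_nonneg_left h1 hε.le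
    have h3 := mul_le_mul_of_nonneg_right hεM (sq_nonneg b)
    nlinarith
  refine ⟨hq', hq'.trans ?_⟩
  have hm : 0 < min s c := lt_min hs hc
  have h1 : min s c / (2 * M) * r ≤ min s c / (2 * M) * (M * (ε ^ 2 * a ^ 2 + b ^ 2)) := by gcongr
  have h2 : min s c / (2 * M) * (M * (ε ^ 2 * a ^ 2 + b ^ 2))
      = (min s c * (ε ^ 2 * a ^ 2) + min s c * b ^ 2) / 2 := by field_simp
  have h3 : min s c * (ε ^ 2 * a ^ 2) ≤ s * (ε * a ^ 2) := by
    have : ε ^ 2 * a ^ 2 ≤ ε * a ^ 2 := by gcongr; nlinarith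
    exact mul_le_mul (min_le_left _ _) this (by positivity) hs.le
  have h4 : min s c * b ^ 2 ≤ c * b ^ 2 := by gcongr; exact min_le_right _ _
  linarith

lemma sheared_norm_scalar_bound {ε a b g h k M q r : ℝ} (hε : 0 < ε) (hε1 : ε ≤ 1)
    (hq0 : 0 ≤ q) (hr0 : 0 ≤ r) (hq : q ≤ g * (a + b)) (hr : r ≤ h * b + ε * (k * (a + b)))
    (hM : 2 * (2 * g ^ 2 + 2 * h ^ 2 + 4 * k ^ 2) ≤ M) :
    (ε * q) ^ 2 + r ^ 2 ≤ M * (ε ^ 2 * a ^ 2 + b ^ 2) := by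
  have h1 : (ε * q) ^ 2 ≤ (ε * (g * (a + b))) ^ 2 := by gcongr
  have h3 : r ^ 2 ≤ (h * b + ε * (k * (a + b))) ^ 2 := by gcongr
  have h4 : (ε * (a + b)) ^ 2 ≤ 2 * (ε ^ 2 * a ^ 2 + b ^ 2) := by
    have h5 : ε ^ 2 * b ^ 2 ≤ 1 * b ^ 2 := by gcongr; nlinarith
    have h6 := sq_nonneg (ε * (a - b))
    linarith
  set N := ε ^ 2 * a ^ 2 + b ^ 2 with hN
  have hbN : b ^ 2 ≤ N := by have : 0 ≤ ε ^ 2 * a ^ 2 := by positivity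
                             linarith
  have h5 := mul_le_mul_of_nonneg_left h4 (sq_nonneg g)
  have h6 := mul_le_mul_of_nonneg_left h4 (sq_nonneg k)
  have h7 := mul_le_mul_of_nonneg_left hbN (sq_nonneg h)
  have hN0 : 0 ≤ N := by positivity
  have h8 := mul_le_mul_of_nonneg_right hM hN0
  have h9 := sq_nonneg (h * b - ε * (k * (a + b)))
  have h10 : 0 ≤ g ^ 2 * N := by positivity
  have h11 : 0 ≤ h ^ 2 * N := by positivity
  have h12 : 0 ≤ k ^ 2 * N := by positivity
  linarith

variable {X Y : Type*} [NormedAddCommGroup X] [InnerProductSpace ℝ X]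
  [NormedAddCommGroup Y] [InnerProductSpace ℝ Y]

/-- The shear `(x, y) ↦ (x, y + D x)` into the Hilbert sum. -/
noncomputable def shear (D : X →L[ℝ] Y) : X × Y →ₗ[ℝ] WithLp 2 (X × Y) :=
  (WithLp.linearEquiv 2 ℝ (X × Y)).symm.toLinearMap ∘ₗ
    (LinearMap.fst ℝ X Y).prod (LinearMap.snd ℝ X Y + D.toLinearMap ∘ₗ LinearMap.fst ℝ X Y)

lemma inner_shear (D : X →L[ℝ] Y) (p q : X × Y) :
    inner ℝ (shear D p) (shear D q)
      = inner ℝ p.1 q.1 + inner ℝ (p.2 + D p.1) (q.2 + D q.1) := by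
  simp [shear, WithLp.prod_inner_apply]

lemma norm_shear_sq (D : X →L[ℝ] Y) (p : X × Y) :
    ‖shear D p‖ ^ 2 = ‖p.1‖ ^ 2 + ‖p.2 + D p.1‖ ^ 2 := by
  rw [← real_inner_self_eq_norm_sq, inner_shear, real_inner_self_eq_norm_sq,
    real_inner_self_eq_norm_sq]

/-- If the quadratic form `H` is negative definite on `Y` and positive definite on the
`H`-orthogonal complement of `Y` (the graph of `-D`), then the descent-ascent field
`(-ε ∂ₓ, ∂ᵧ)` of `H` is dissipative in sheared coordinates for small `ε`. -/
lemma exists_dissipative [FiniteDimensional ℝ X] [FiniteDimensional ℝ Y]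
    {H : X × Y →L[ℝ] X × Y →L[ℝ] ℝ} {D : X →L[ℝ] Y} {gx : X × Y →L[ℝ] X} {gy : X × Y →L[ℝ] Y}
    (hsymm : ∀ p q, H p q = H q p)
    (hgx : ∀ p u, inner ℝ (gx p) u = H p (u, 0)) (hgy : ∀ p u, inner ℝ (gy p) u = H p (0, u))
    (horth : ∀ x y, H (x, -D x) (0, y) = 0)
    (hpos : ∀ x, x ≠ 0 → 0 < H (x, -D x) (x, -D x)) (hneg : ∀ y, y ≠ 0 → H (0, y) (0, y) < 0) :
    ∃ ε₀ c : ℝ, 0 < ε₀ ∧ 0 < c ∧ ∀ ε, 0 < ε → ε < ε₀ → ∀ p : X × Y,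
      (p ≠ 0 → inner ℝ (shear D p) (shear D (-(ε • gx p), gy p)) < 0) ∧
      inner ℝ (shear D p) (shear D (-(ε • gx p), gy p))
        ≤ -c * ‖shear D (-(ε • gx p), gy p)‖ ^ 2 := by
  let i : X →L[ℝ] X × Y := (ContinuousLinearMap.id ℝ X).prod (-D)
  let j : Y →L[ℝ] X × Y := ContinuousLinearMap.inr ℝ X Y
  obtain ⟨s, hs, hsx⟩ := exists_coercive (B := H.bilinearComp i i)
    (fun x hx => by simpa [i] using hpos x hx)
  obtain ⟨c, hc, hcy⟩ := exists_coercive (B := -H.bilinearComp j j)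
    (fun y hy => by simpa [j] using hneg y hy)
  set d := ‖D‖ with hd
  set g := ‖gx‖ * (1 + d) with hg
  set h := ‖gy‖ with hh
  have hd0 : 0 ≤ d := norm_nonneg _
  have hg0 : 0 ≤ g := by positivity
  have hh0 : 0 ≤ h := norm_nonneg gy
  -- One constant serves two purposes: it bounds the cross terms of the energy product and the
  -- squared norm of the sheared field.
  obtain ⟨M, hM0, hM1, hM2⟩ : ∃ M : ℝ, 0 < M ∧ h * d + d * g ≤ M ∧
      2 * g ^ 2 + 2 * h ^ 2 + 4 * (d * g) ^ 2 ≤ M / 2 := by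
    refine ⟨1 + (h * d + d * g) + 2 * (2 * g ^ 2 + 2 * h ^ 2 + 4 * (d * g) ^ 2),
      by positivity, ?_, ?_⟩
    · have : 0 ≤ 2 * (2 * g ^ 2 + 2 * h ^ 2 + 4 * (d * g) ^ 2) := by positivity
      linarith
    · have : 0 ≤ h * d + d * g := by positivity
      linarith
  have hK : 0 < M + M ^ 2 / (2 * s) := by positivity
  refine ⟨min 1 (c / 2 / (M + M ^ 2 / (2 * s))), min s c / (2 * M), by positivity,
    by positivity, fun ε hε hε₀ p => ?_⟩
  have hε1 : ε ≤ 1 := hε₀.le.trans (min_le_left _ _)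
  have hεM : ε * (M + M ^ 2 / (2 * s)) ≤ c / 2 :=
    (le_div_iff₀ hK).1 (hε₀.le.trans (min_le_right _ _))
  obtain ⟨x, y⟩ := p
  set w := y + D x with hw
  have hp : ((x, y) : X × Y) = (x, -D x) + (0, w) := by simp [hw]
  -- The decoupling: by `horth`, the y-gradient does not see the component (x, -D x).
  have hgyw : gy (x, y) = gy (0, w) := by
    refine ext_inner_right ℝ fun u => ?_
    rw [hgy, hgy, hp, map_add, add_apply, horth, zero_add]
  have hgyn : ‖gy (x, y)‖ ≤ h * ‖w‖ := by
    rw [hgyw]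
    refine (gy.le_opNorm _).trans ?_
    simp [Prod.norm_def, hh]
  have hDx : ‖D x‖ ≤ d * ‖x‖ := D.le_opNorm x
  have hgxn : ‖gx (x, y)‖ ≤ g * (‖x‖ + ‖w‖) := by
    refine (gx.le_opNorm _).trans ?_
    rw [hg, mul_assoc]
    gcongr
    rw [hp]
    refine (norm_add_le _ _).trans ?_
    have h1 : ‖((x, -D x) : X × Y)‖ ≤ (1 + d) * ‖x‖ := by
      simp only [Prod.norm_def, norm_neg]
      refine max_le ?_ ?_ <;> nlinarith [norm_nonneg x]
    have h2 : ‖((0, w) : X × Y)‖ = ‖w‖ := by simp [Prod.norm_def]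
    rw [h2]
    nlinarith [norm_nonneg w]
  have hDg : ‖D (gx (x, y))‖ ≤ d * g * (‖x‖ + ‖w‖) := by
    refine (D.le_opNorm _).trans ?_
    rw [mul_assoc]
    gcongr
  have hgyin : inner ℝ (gy (x, y)) w ≤ -(c * ‖w‖ ^ 2) := by
    have := hcy w
    simp [j] at this
    rw [hgyw, hgy]
    linarith
  have hgxin : s * ‖x‖ ^ 2 - h * d * (‖x‖ * ‖w‖) ≤ inner ℝ (gx (x, y)) x := by
    -- Splitting (x, 0) = (x, -D x) + (0, D x) isolates the Schur complement form; the remainder is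
    -- of size ‖x‖‖w‖.
    have h1 : inner ℝ (gx (x, y)) x
        = H (x, -D x) (x, -D x) + inner ℝ (gy (x, y)) (D x) := by
      have hx : ((x, 0) : X × Y) = (x, -D x) + (0, D x) := by simp
      rw [hgx, hx, map_add, ← hgy, hp, map_add, add_apply,
        hsymm (0, w), horth, add_zero]
    have h2 := hsx x
    simp [i] at h2
    have h3 := (abs_le.1 (abs_real_inner_le_norm (gy (x, y)) (D x))).1
    have h4 : ‖gy (x, y)‖ * ‖D x‖ ≤ (h * ‖w‖) * (d * ‖x‖) := by gcongr
    rw [h1]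
    linarith
  have hDin : -inner ℝ w (D (gx (x, y))) ≤ d * g * (‖x‖ + ‖w‖) * ‖w‖ := by
    have h3 := (abs_le.1 (abs_real_inner_le_norm w (D (gx (x, y))))).1
    have h4 : ‖w‖ * ‖D (gx (x, y))‖ ≤ ‖w‖ * (d * g * (‖x‖ + ‖w‖)) := by gcongr
    linarith
  have hq : inner ℝ (shear D (x, y)) (shear D (-(ε • gx (x, y)), gy (x, y)))
      ≤ -(ε * s * ‖x‖ ^ 2) - c * ‖w‖ ^ 2 + ε * M * (‖x‖ + ‖w‖) * ‖w‖ := by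
    rw [inner_shear]
    simp only [← hw, map_neg, map_smul, inner_add_right, inner_neg_right, inner_smul_right]
    rw [real_inner_comm (gx (x, y)), real_inner_comm (gy (x, y))]
    have h5 : (h * d + d * g) * ((‖x‖ + ‖w‖) * ‖w‖) ≤ M * ((‖x‖ + ‖w‖) * ‖w‖) := by
      gcongr
    have h6 : h * d * (‖x‖ * ‖w‖) ≤ h * d * ((‖x‖ + ‖w‖) * ‖w‖) := by
      gcongr
      linarith [norm_nonneg w]
    have h7 := mul_le_mul_of_nonneg_left hgxin hε.le
    have h8 := mul_le_mul_of_nonneg_left hDin hε.le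
    have h9 := mul_le_mul_of_nonneg_left h5 hε.le
    have h10 := mul_le_mul_of_nonneg_left h6 hε.le
    linarith
  have hr : ‖shear D (-(ε • gx (x, y)), gy (x, y))‖ ^ 2
      ≤ M * (ε ^ 2 * ‖x‖ ^ 2 + ‖w‖ ^ 2) := by
    rw [norm_shear_sq]
    simp only [map_neg, map_smul, norm_neg, norm_smul, Real.norm_of_nonneg hε.le]
    have h2 : ‖gy (x, y) + -(ε • D (gx (x, y)))‖
        ≤ h * ‖w‖ + ε * (d * g * (‖x‖ + ‖w‖)) := by
      refine (norm_add_le _ _).trans ?_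
      rw [norm_neg, norm_smul, Real.norm_of_nonneg hε.le]
      gcongr
    exact sheared_norm_scalar_bound hε hε1 (by positivity) (norm_nonneg _) hgxn h2
      (by linarith)
  obtain ⟨h1, h2⟩ := energy_scalar_bound hs hc hM0 hε hε1 hεM hq hr
  refine ⟨fun hp0 => h1.trans_lt ?_, h2⟩
  suffices 0 < ε * s * ‖x‖ ^ 2 + c * ‖w‖ ^ 2 by linarith
  rcases eq_or_ne x 0 with hx | hx
  · have hw0 : w ≠ 0 := fun h0 => hp0 (by rw [hp, h0, hx]; simp)
    have : 0 < ‖w‖ := norm_pos_iff.2 hw0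
    positivity
  · have : 0 < ‖x‖ := norm_pos_iff.2 hx
    positivity

end Energy

/-! ### Derivatives of the gradients, the field and the update maps. -/

section Derivatives

variable {n m : ℕ} {f : Pair n m → ℝ} {z : Pair n m}

/-- The inverse Riesz isomorphism of a real Euclidean space, as a linear map. -/
noncomputable def riesz (n : ℕ) :
    (EuclideanSpace ℝ (Fin n) →L[ℝ] ℝ) →L[ℝ] EuclideanSpace ℝ (Fin n) :=
  LinearMap.toContinuousLinearMap
    { toFun := (InnerProductSpace.toDual ℝ (EuclideanSpace ℝ (Fin n))).symm
      map_add' := map_add _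
      map_smul' := fun c φ => by simp }

lemma riesz_apply (φ : EuclideanSpace ℝ (Fin n) →L[ℝ] ℝ) :
    riesz n φ = (InnerProductSpace.toDual ℝ (EuclideanSpace ℝ (Fin n))).symm φ := rfl

lemma inner_riesz (φ : EuclideanSpace ℝ (Fin n) →L[ℝ] ℝ) (u : EuclideanSpace ℝ (Fin n)) :
    inner ℝ (riesz n φ) u = φ u := by
  rw [riesz_apply, InnerProductSpace.toDual_symm_apply]

/-- The Hessian of `f` at `z` as a bilinear form. -/
noncomputable def hess (f : Pair n m → ℝ) (z : Pair n m) : Pair n m →L[ℝ] Pair n m →L[ℝ] ℝ :=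
  fderiv ℝ (fderiv ℝ f) z

/-- The derivative of `gradX f` at `z`. -/
noncomputable def gradXDeriv (f : Pair n m → ℝ) (z : Pair n m) :
    Pair n m →L[ℝ] EuclideanSpace ℝ (Fin n) :=
  riesz n ∘L ((ContinuousLinearMap.compL ℝ _ (Pair n m) ℝ).flip (.inl ℝ _ _)) ∘L hess f z

/-- The derivative of `gradY f` at `z`. -/
noncomputable def gradYDeriv (f : Pair n m → ℝ) (z : Pair n m) :
    Pair n m →L[ℝ] EuclideanSpace ℝ (Fin m) :=
  riesz m ∘L ((ContinuousLinearMap.compL ℝ _ (Pair n m) ℝ).flip (.inr ℝ _ _)) ∘L hess f z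

lemma inner_gradXDeriv (p : Pair n m) (u : EuclideanSpace ℝ (Fin n)) :
    inner ℝ (gradXDeriv f z p) u = hess f z p (u, 0) := by
  simp [gradXDeriv, inner_riesz]

lemma inner_gradYDeriv (p : Pair n m) (u : EuclideanSpace ℝ (Fin m)) :
    inner ℝ (gradYDeriv f z p) u = hess f z p (0, u) := by
  simp [gradYDeriv, inner_riesz]

lemma gradX_eq (hf : ContDiff ℝ 2 f) (z : Pair n m) :
    gradX f z = riesz n ((fderiv ℝ f z).comp (.inl ℝ _ _)) := by
  have h : HasFDerivAt (fun x => f (x, z.2)) ((fderiv ℝ f z).comp (.inl ℝ _ _)) z.1 :=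
    HasFDerivAt.comp (g := f) z.1 ((hf.differentiable (by norm_num)) z).hasFDerivAt
      (hasFDerivAt_prodMk_left z.1 z.2)
  rw [gradX, gradient, h.fderiv, riesz_apply]

lemma gradY_eq (hf : ContDiff ℝ 2 f) (z : Pair n m) :
    gradY f z = riesz m ((fderiv ℝ f z).comp (.inr ℝ _ _)) := by
  have h : HasFDerivAt (fun y => f (z.1, y)) ((fderiv ℝ f z).comp (.inr ℝ _ _)) z.2 :=
    HasFDerivAt.comp (g := f) z.2 ((hf.differentiable (by norm_num)) z).hasFDerivAt
      (hasFDerivAt_prodMk_right z.1 z.2)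
  rw [gradY, gradient, h.fderiv, riesz_apply]

lemma hasFDerivAt_fderiv (hf : ContDiff ℝ 2 f) (z : Pair n m) :
    HasFDerivAt (fderiv ℝ f) (hess f z) z :=
  ((hf.fderiv_right (m := 1) (by norm_num)).differentiable (by norm_num) z).hasFDerivAt

lemma hasFDerivAt_gradX (hf : ContDiff ℝ 2 f) (z : Pair n m) :
    HasFDerivAt (gradX f) (gradXDeriv f z) z := by
  rw [show gradX f = _ from funext (gradX_eq hf)]
  exact ((riesz n).hasFDerivAt.comp z
    ((((ContinuousLinearMap.compL ℝ _ (Pair n m) ℝ).flip (.inl ℝ _ _)).hasFDerivAt).comp z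
      (hasFDerivAt_fderiv hf z)))

lemma hasFDerivAt_gradY (hf : ContDiff ℝ 2 f) (z : Pair n m) :
    HasFDerivAt (gradY f) (gradYDeriv f z) z := by
  rw [show gradY f = _ from funext (gradY_eq hf)]
  exact ((riesz m).hasFDerivAt.comp z
    ((((ContinuousLinearMap.compL ℝ _ (Pair n m) ℝ).flip (.inr ℝ _ _)).hasFDerivAt).comp z
      (hasFDerivAt_fderiv hf z)))

/-- The derivative of the two-time-scale field at `z`. -/
noncomputable def fieldDeriv (f : Pair n m → ℝ) (α₁ α₂ : ℝ) (z : Pair n m) :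
    Pair n m →L[ℝ] Pair n m :=
  (-(α₁ • gradXDeriv f z)).prod (α₂ • gradYDeriv f z)

lemma hasFDerivAt_field (hf : ContDiff ℝ 2 f) (α₁ α₂ : ℝ) (z : Pair n m) :
    HasFDerivAt (field f α₁ α₂) (fieldDeriv f α₁ α₂ z) z :=
  ((hasFDerivAt_gradX hf z).const_smul α₁).neg.prodMk ((hasFDerivAt_gradY hf z).const_smul α₂)

lemma field_eq_zero (hz : IsStationary f z) (α₁ α₂ : ℝ) : field f α₁ α₂ z = 0 := by
  simp [field, hz.1, hz.2]

lemma hasFDerivAt_egStep (hf : ContDiff ℝ 2 f) (hz : IsStationary f z) (α₁ α₂ β : ℝ) :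
    HasFDerivAt (egStep f α₁ α₂ β) (.id ℝ _ + β⁻¹ • (fieldDeriv f α₁ α₂ z) ∘L
      (.id ℝ _ + fieldDeriv f α₁ α₂ z)) z := by
  have h1 := hasFDerivAt_field hf α₁ α₂ z
  have h2 : HasFDerivAt (fun q => q + field f α₁ α₂ q) (.id ℝ _ + fieldDeriv f α₁ α₂ z) z :=
    (hasFDerivAt_id z).add h1
  -- The half step fixes z by stationarity, so both evaluations of the field are linearized at z.
  have h3 : HasFDerivAt (field f α₁ α₂) (fieldDeriv f α₁ α₂ z) (z + field f α₁ α₂ z) := by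
    rwa [field_eq_zero hz, add_zero]
  exact (hasFDerivAt_id z).add ((h3.comp z h2).const_smul β⁻¹)

lemma hasFDerivAt_ogdStep (hf : ContDiff ℝ 2 f) (k α₁ α₂ : ℝ) (z : Pair n m) :
    HasFDerivAt (ogdStep f k α₁ α₂)
      ((ContinuousLinearMap.fst ℝ (Pair n m) (Pair n m) + k • (fieldDeriv f α₁ α₂ z) ∘L .fst ℝ _ _
        - (fieldDeriv f α₁ α₂ z) ∘L .snd ℝ _ _).prod (.fst ℝ _ _)) (z, z) := by
  have h1 : HasFDerivAt (fun s : Pair n m × Pair n m => field f α₁ α₂ s.1)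
      ((fieldDeriv f α₁ α₂ z) ∘L .fst ℝ _ _) (z, z) :=
    HasFDerivAt.comp (g := field f α₁ α₂) (z, z) (hasFDerivAt_field hf α₁ α₂ z) hasFDerivAt_fst
  have h2 : HasFDerivAt (fun s : Pair n m × Pair n m => field f α₁ α₂ s.2)
      ((fieldDeriv f α₁ α₂ z) ∘L .snd ℝ _ _) (z, z) :=
    HasFDerivAt.comp (g := field f α₁ α₂) (z, z) (hasFDerivAt_field hf α₁ α₂ z) hasFDerivAt_snd
  exact ((hasFDerivAt_fst.add (h1.const_smul k)).sub h2).prodMk hasFDerivAt_fst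

end Derivatives

/-! ### Block Hessian matrices, Schur complement and orthogonality. -/

section HessianBlocks

open Matrix

variable {n m : ℕ} {f : Pair n m → ℝ} {z : Pair n m}

lemma secondDeriv_eq (hf : ContDiff ℝ 2 f) (z u w : Pair n m) :
    secondDeriv f z u w = hess f z u w := by
  have h := (hasFDerivAt_fderiv hf z).clm_apply (hasFDerivAt_const w z)
  rw [secondDeriv, h.fderiv]
  simp

lemma hess_symm (hf : ContDiff ℝ 2 f) (z p q : Pair n m) : hess f z p q = hess f z q p :=
  (hf.contDiffAt.isSymmSndFDerivAt (by simp)) p q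

lemma bilin_eq_dotProduct_mulVec {ι κ : Type*} [Fintype ι] [Fintype κ] [DecidableEq ι]
    [DecidableEq κ] (B : EuclideanSpace ℝ ι →L[ℝ] EuclideanSpace ℝ κ →L[ℝ] ℝ)
    (x : EuclideanSpace ℝ ι) (y : EuclideanSpace ℝ κ) :
    B x y = x.ofLp ⬝ᵥ (Matrix.of fun i j =>
      B (EuclideanSpace.single i 1) (EuclideanSpace.single j 1)) *ᵥ y.ofLp := by
  conv_lhs => rw [← (EuclideanSpace.basisFun ι ℝ).sum_repr x,
    ← (EuclideanSpace.basisFun κ ℝ).sum_repr y]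
  simp [dotProduct, mulVec, Finset.mul_sum, mul_comm, mul_left_comm]
  exact Finset.sum_comm

lemma hess_eq_dotProduct (hf : ContDiff ℝ 2 f) (z : Pair n m) (x x' : EuclideanSpace ℝ (Fin n))
    (y y' : EuclideanSpace ℝ (Fin m)) :
    hess f z (x, y) (x', y') = x.ofLp ⬝ᵥ hessXX f z *ᵥ x'.ofLp + x.ofLp ⬝ᵥ hessXY f z *ᵥ y'.ofLp
      + y.ofLp ⬝ᵥ hessYX f z *ᵥ x'.ofLp + y.ofLp ⬝ᵥ hessYY f z *ᵥ y'.ofLp := by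
  have hp : ((x, y) : Pair n m) = (x, 0) + (0, y) := by simp
  have hq : ((x', y') : Pair n m) = (x', 0) + (0, y') := by simp
  let ι := ContinuousLinearMap.inl ℝ (EuclideanSpace ℝ (Fin n)) (EuclideanSpace ℝ (Fin m))
  let κ := ContinuousLinearMap.inr ℝ (EuclideanSpace ℝ (Fin n)) (EuclideanSpace ℝ (Fin m))
  have h1 := bilin_eq_dotProduct_mulVec ((hess f z).bilinearComp ι ι) x x'
  have h2 := bilin_eq_dotProduct_mulVec ((hess f z).bilinearComp ι κ) x y'
  have h3 := bilin_eq_dotProduct_mulVec ((hess f z).bilinearComp κ ι) y x'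
  have h4 := bilin_eq_dotProduct_mulVec ((hess f z).bilinearComp κ κ) y y'
  simp only [ContinuousLinearMap.bilinearComp_apply, ι, κ, ContinuousLinearMap.inl_apply,
    ContinuousLinearMap.inr_apply] at h1 h2 h3 h4
  simp only [hp, hq, map_add, _root_.add_apply, h1, h2, h3, h4]
  simp only [hessXX, hessXY, hessYX, hessYY, secondDeriv_eq hf, dirX, dirY]
  ring

/-- The map `x ↦ (∂²ᵧᵧ f)⁻¹ ∂²ᵧₓ f x`. -/
noncomputable def schurMap (f : Pair n m → ℝ) (z : Pair n m) :
    EuclideanSpace ℝ (Fin n) →L[ℝ] EuclideanSpace ℝ (Fin m) :=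
  LinearMap.toContinuousLinearMap (Matrix.toEuclideanLin ((hessYY f z)⁻¹ * hessYX f z))

lemma schurMap_ofLp (x : EuclideanSpace ℝ (Fin n)) :
    (schurMap f z x).ofLp = ((hessYY f z)⁻¹ * hessYX f z) *ᵥ x.ofLp := rfl

lemma hessXY_transpose (hf : ContDiff ℝ 2 f) (z : Pair n m) : (hessXY f z)ᵀ = hessYX f z := by
  ext i j
  simp [hessXY, hessYX, secondDeriv_eq hf, hess_symm hf z (dirX n m j)]

lemma hessYY_transpose (hf : ContDiff ℝ 2 f) (z : Pair n m) : (hessYY f z)ᵀ = hessYY f z := by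
  ext i j
  simp [hessYY, secondDeriv_eq hf, hess_symm hf z (dirY n m j)]

lemma hess_neg_of_posDef (hf : ContDiff ℝ 2 f) (hyy : (-(hessYY f z)).PosDef)
    (y : EuclideanSpace ℝ (Fin m)) (hy : y ≠ 0) : hess f z (0, y) (0, y) < 0 := by
  have h := (posDef_iff_dotProduct_mulVec.1 hyy).2 (x := y.ofLp) (by simpa using hy)
  rw [hess_eq_dotProduct hf]
  simp [neg_mulVec] at h ⊢
  exact h

lemma hess_schur_orthogonal (hf : ContDiff ℝ 2 f) (hyy : (-(hessYY f z)).PosDef)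
    (x : EuclideanSpace ℝ (Fin n)) (y : EuclideanSpace ℝ (Fin m)) :
    hess f z (x, -schurMap f z x) (0, y) = 0 := by
  -- Definiteness makes the matrix inverse a genuine one rather than the default value.
  have hu : IsUnit (hessYY f z).det := by
    rw [← Matrix.isUnit_iff_isUnit_det]
    simpa using hyy.isUnit.neg
  rw [hess_eq_dotProduct hf]
  simp only [WithLp.ofLp_neg, WithLp.ofLp_zero, mulVec_zero, dotProduct_zero, zero_add, add_zero,
    neg_dotProduct, schurMap_ofLp]
  rw [dotProduct_mulVec _ (hessYY f z), ← mulVec_transpose, hessYY_transpose hf, mulVec_mulVec,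
    Matrix.mul_nonsing_inv_cancel_left _ _ hu, dotProduct_mulVec, ← mulVec_transpose,
    hessXY_transpose hf, add_neg_cancel]

lemma hess_schur_pos (hf : ContDiff ℝ 2 f) (hyy : (-(hessYY f z)).PosDef)
    (hschur : (hessXX f z - hessXY f z * (hessYY f z)⁻¹ * hessYX f z).PosDef)
    (x : EuclideanSpace ℝ (Fin n)) (hx : x ≠ 0) :
    0 < hess f z (x, -schurMap f z x) (x, -schurMap f z x) := by
  have h := (posDef_iff_dotProduct_mulVec.1 hschur).2 (x := x.ofLp) (by simpa using hx)
  have hq : ((x, -schurMap f z x) : Pair n m) = (x, 0) + (0, -schurMap f z x) := by simp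
  -- Orthogonality to the y-directions lets one argument be replaced by (x, 0), leaving exactly the
  -- Schur complement form.
  have h0 : hess f z (x, -schurMap f z x) (x, -schurMap f z x)
      = hess f z (x, 0) (x, -schurMap f z x) := by
    conv_lhs => enter [1, 2]; rw [hq]
    rw [map_add, _root_.add_apply, hess_symm hf z (0, _), hess_schur_orthogonal hf hyy, add_zero]
  rw [h0, hess_eq_dotProduct hf]
  simp only [WithLp.ofLp_neg, WithLp.ofLp_zero, zero_dotProduct, add_zero, schurMap_ofLp,
    mulVec_neg, dotProduct_neg, mulVec_mulVec]
  simpa [sub_mulVec, Matrix.mul_assoc] using h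

end HessianBlocks

/-! ### Uniform eigenvalue bound and stability of the two methods. -/

section Main

variable {n m : ℕ} {f : Pair n m → ℝ} {z : Pair n m}

/-- Under the second-order sufficient condition, for a small enough time-scale ratio, every
eigenvalue `s` of the linearized field satisfies `Re s ≤ -(c / α₂) |s|²` uniformly. -/
lemma exists_eigenvalue_bound (hf : ContDiff ℝ 2 f) (hyy : (-(hessYY f z)).PosDef)
    (hschur : (hessXX f z - hessXY f z * (hessYY f z)⁻¹ * hessYX f z).PosDef) :
    ∃ γ₀ c : ℝ, 0 < γ₀ ∧ 0 < c ∧ ∀ γ α₁ α₂ : ℝ, γ₀ < γ → 0 < α₂ → α₁ = α₂ / γ →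
      ∀ (s : ℂ) (v : ℂ ⊗[ℝ] Pair n m), v ≠ 0 →
        (fieldDeriv f α₁ α₂ z : Pair n m →ₗ[ℝ] Pair n m).baseChange ℂ v = s • v →
        s.re < 0 ∧ s.re ≤ -(c / α₂) * (s.re ^ 2 + s.im ^ 2) := by
  obtain ⟨ε₀, c, hε₀, hc, H⟩ := exists_dissipative (hess_symm hf z) inner_gradXDeriv
    inner_gradYDeriv (hess_schur_orthogonal hf hyy) (hess_schur_pos hf hyy hschur)
    (hess_neg_of_posDef hf hyy)
  refine ⟨ε₀⁻¹, c, by positivity, hc, fun γ α₁ α₂ hγ hα₂ hα₁ s v hv hs => ?_⟩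
  have hγ0 : 0 < γ := (inv_pos.2 hε₀).trans hγ
  have hγε : γ⁻¹ < ε₀ := inv_lt_of_inv_lt₀ hε₀ hγ
  have hV : ∀ p, fieldDeriv f α₁ α₂ z p
      = α₂ • ((-(γ⁻¹ • gradXDeriv f z p), gradYDeriv f z p) : Pair n m) := fun p => by
    simp [fieldDeriv, hα₁, smul_smul, div_eq_mul_inv]
  refine eigenvalue_re_of_dissipative (L := shear (schurMap f z)) (fun p hp => ?_) (fun p => ?_)
    hv hs
  · have := (H γ⁻¹ (by positivity) hγε p).1 hp
    rw [ContinuousLinearMap.coe_coe, hV, map_smul, inner_smul_right]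
    exact mul_neg_of_pos_of_neg hα₂ this
  · have := (H γ⁻¹ (by positivity) hγε p).2
    rw [ContinuousLinearMap.coe_coe, hV, map_smul, inner_smul_right, norm_smul,
      Real.norm_of_nonneg hα₂.le, mul_pow]
    refine (mul_le_mul_of_nonneg_left this hα₂.le).trans (le_of_eq ?_)
    field_simp

lemma egStep_exponentiallyStable (hf : ContDiff ℝ 2 f) (hz : IsStationary f z)
    {α₁ α₂ β c : ℝ} (hβ : 0 < β) (hc : 1 + 2 / β < c)
    (hs : ∀ (s : ℂ) (v : ℂ ⊗[ℝ] Pair n m), v ≠ 0 →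
      (fieldDeriv f α₁ α₂ z : Pair n m →ₗ[ℝ] Pair n m).baseChange ℂ v = s • v →
      s.re < 0 ∧ s.re ≤ -c * (s.re ^ 2 + s.im ^ 2)) :
    ExponentiallyStable (egStep f α₁ α₂ β) z := by
  have hd := hasFDerivAt_egStep hf hz α₁ α₂ β
  refine ⟨by simp [egStep, field_eq_zero hz], hd.differentiableAt, ?_⟩
  rw [hd.fderiv]
  refine spectralRadius_lt_one fun μ hμ => ?_
  obtain ⟨s, v, hv, hsv, rfl⟩ := extragradient_spectrum hβ hμ
  exact extragradient_multiplier_lt_one hβ (hs s v hv hsv).1 (hs s v hv hsv).2 hc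

lemma ogdStep_exponentiallyStable (hf : ContDiff ℝ 2 f) (hz : IsStationary f z)
    {α₁ α₂ k c : ℝ} (hk : 1 < k) (hc : (k + 1) / 2 < c)
    (hs : ∀ (s : ℂ) (v : ℂ ⊗[ℝ] Pair n m), v ≠ 0 →
      (fieldDeriv f α₁ α₂ z : Pair n m →ₗ[ℝ] Pair n m).baseChange ℂ v = s • v →
      s.re < 0 ∧ s.re ≤ -c * (s.re ^ 2 + s.im ^ 2)) :
    ExponentiallyStable (ogdStep f k α₁ α₂) (z, z) := by
  have hd := hasFDerivAt_ogdStep hf k α₁ α₂ z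
  refine ⟨by simp [ogdStep, field_eq_zero hz], hd.differentiableAt, ?_⟩
  rw [hd.fderiv]
  refine spectralRadius_lt_one fun μ hμ => ?_
  by_contra! h1
  obtain ⟨s, v, hv, hsv, h⟩ := optimistic_spectrum hk h1 hμ
  exact h1.not_gt (optimistic_multiplier_lt_one hk (hs s v hv hsv).1 (hs s v hv hsv).2 hc h)

end Main

end MinimaxStability

theorem mainTheorem11 (n m : ℕ) (f : MinimaxStability.Pair n m → ℝ) (hf : ContDiff ℝ 2 f)
    (z : MinimaxStability.Pair n m) (hz : MinimaxStability.IsStationary f z)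
    (hyy : (-(MinimaxStability.hessYY f z)).PosDef)
    (hschur : (MinimaxStability.hessXX f z -
      MinimaxStability.hessXY f z * (MinimaxStability.hessYY f z)⁻¹ *
        MinimaxStability.hessYX f z).PosDef) :
    ∃ γ₀ : ℝ, 0 < γ₀ ∧ ∀ β₀ : ℝ, 0 < β₀ → ∀ K : ℝ, 1 < K →
      ∃ α₀ : ℝ, 0 < α₀ ∧ ∀ γ α₁ α₂ : ℝ, γ₀ < γ → 0 < α₂ → α₂ < α₀ → α₁ = α₂ / γ →
        (∀ β : ℝ, β₀ ≤ β →
          MinimaxStability.ExponentiallyStable (MinimaxStability.egStep f α₁ α₂ β) z) ∧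
        (∀ k : ℝ, 1 < k → k ≤ K →
          MinimaxStability.ExponentiallyStable (MinimaxStability.ogdStep f k α₁ α₂) (z, z)) := by
  obtain ⟨γ₀, c, hγ₀, hc, H⟩ := MinimaxStability.exists_eigenvalue_bound hf hyy hschur
  refine ⟨γ₀, hγ₀, fun β₀ hβ₀ K hK => ?_⟩
  -- α₂ below this value makes c/α₂ exceed the sum of the EG threshold 1 + 2/β₀ and the OGD
  -- threshold (K+1)/2, hence each of them. Both are worst at β = β₀ and k = K.
  refine ⟨c / (1 + 2 / β₀ + (K + 1) / 2), by positivity,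
    fun γ α₁ α₂ hγ hα₂ hα₀ hα₁ => ?_⟩
  have hlarge : 1 + 2 / β₀ + (K + 1) / 2 < c / α₂ := by
    rw [lt_div_iff₀ (by positivity)] at hα₀
    rw [lt_div_iff₀ hα₂]
    linarith
  refine ⟨fun β hβ => ?_, fun k hk hkK => ?_⟩
  · refine MinimaxStability.egStep_exponentiallyStable hf hz (hβ₀.trans_le hβ) ?_
      (H γ α₁ α₂ hγ hα₂ hα₁)
    have : 2 / β ≤ 2 / β₀ := by gcongr
    linarith
  · refine MinimaxStability.ogdStep_exponentiallyStable hf hz hk ?_ (H γ α₁ α₂ hγ hα₂ hα₁)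
    have : 0 < 2 / β₀ := by positivity
    linarith
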